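/- Use rectangular coordinates in Euclidean $\mathbb R^3$, with metric $g_{ij}=\delta_{ij}$, Levi-Civita symbol $\epsilon_{ijk}$ ($\epsilon_{123}=1$), and summation over repeated indices. Let $\mathcal C$ be the 21-dimensional real vector space of elasticity tensors, that is, of fourth-rank tensors $C_{ijkl}$ ($i,j,k,l\in\{1,2,3\}$) with $C_{ijkl}=C_{jikl}=C_{klij}$. The rotation group $SO(3)$ acts on $\mathcal C$ by $(O\cdot C)_{ijkl}=O_{ia}O_{jb}O_{kc}O_{ld}C_{abcd}$. A quadratic invariant is a function $I:\mathcal C\to\mathbb R$ of the form $I(C)=f_{ijklpqrs}C_{ijkl}C_{pqrs}$, with constant real coefficients $f_{ijklpqrs}$, such that $I(O\cdot C)=I(C)$ for all $O\in SO(3)$ and $C\in\mathcal C$. For $C\in\mathcal C$ put $$S_{ijkl}=\tfrac13(C_{ijkl}+C_{iklj}+C_{iljk}),\qquad A_{ijkl}=C_{ijkl}-S_{ijkl},$$ $$S_{ij}=g_{kl}S_{ijkl},\qquad S=g_{ij}S_{ij},\qquad P_{ij}=S_{ij}-\tfrac13 S g_{ij},$$ $$R_{ijkl}=S_{ijkl}-\tfrac1{15}S\,(g_{ij}g_{kl}+g_{ik}g_{jl}+g_{il}g_{jk})-\tfrac17\,(P_{ij}g_{kl}+P_{ik}g_{jl}+P_{il}g_{jk}+P_{jk}g_{il}+P_{jl}g_{ik}+P_{kl}g_{ij}),$$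 $$\Delta_{mn}=\tfrac13\,\epsilon_{mil}\,\epsilon_{njk}A_{ijkl},\qquad A=g_{mn}\Delta_{mn},\qquad Q_{ij}=\Delta_{ij}-\tfrac13A g_{ij}.$$ Then the seven functions $$Z_1=S^2,\quad Z_2=AS,\quad Z_3=A^2,\quad Z_4=P_{ij}P_{ij},\quad Z_5=P_{ij}Q_{ij},\quad Z_6=Q_{ij}Q_{ij},\quad Z_7=R_{ijkl}R_{ijkl}$$ are quadratic invariants of $C$; every quadratic invariant is a linear combination of $Z_1,\dots,Z_7$ with real coefficients; and $Z_1,\dots,Z_7$ are linearly independent as functions on $\mathcal C$. Hence they form a basis of the real vector space of quadratic invariants. -/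

import Mathlib

/-!
Tensors over Euclidean three-space are given by their components in rectangular (orthonormal)
coordinates, so that the metric is the Kronecker delta and upper and lower indices agree.
-/

namespace Elasticity

/-- Components of a second-rank tensor. -/
abbrev Tensor2 := Fin 3 → Fin 3 → ℝ

/-- Components of a fourth-rank tensor. -/
abbrev Tensor4 := Fin 3 → Fin 3 → Fin 3 → Fin 3 → ℝ

/-- The vector space of elasticity tensors: `C_{ijkl} = C_{jikl} = C_{klij}`. -/
def elasticitySpace : Submodule ℝ Tensor4 where
  carrier := {C | (∀ i j k l, C i j k l = C j i k l) ∧ (∀ i j k l, C i j k l = C k l i j)}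
  zero_mem' := ⟨fun _ _ _ _ => rfl, fun _ _ _ _ => rfl⟩
  add_mem' := by
    rintro C D ⟨hC₁, hC₂⟩ ⟨hD₁, hD₂⟩
    refine ⟨fun i j k l => ?_, fun i j k l => ?_⟩
    · simp only [Pi.add_apply]
      rw [hC₁, hD₁]
    · simp only [Pi.add_apply]
      rw [hC₂, hD₂]
  smul_mem' := by
    rintro a C ⟨hC₁, hC₂⟩
    refine ⟨fun i j k l => ?_, fun i j k l => ?_⟩
    · simp only [Pi.smul_apply]
      rw [hC₁]
    · simp only [Pi.smul_apply]
      rw [hC₂]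

/-- The action of a matrix on fourth-rank tensors,
`(O · C)_{ijkl} = O_{ia} O_{jb} O_{kc} O_{ld} C_{abcd}`. -/
def rotate (O : Matrix (Fin 3) (Fin 3) ℝ) (C : Tensor4) : Tensor4 := fun i j k l =>
  ∑ a, ∑ b, ∑ c, ∑ d, O i a * O j b * O k c * O l d * C a b c d

theorem rotate_mem (O : Matrix (Fin 3) (Fin 3) ℝ) {C : Tensor4} (hC : C ∈ elasticitySpace) :
    rotate O C ∈ elasticitySpace := by
  obtain ⟨h₁, h₂⟩ := hC
  refine ⟨fun i j k l => ?_, fun i j k l => ?_⟩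
  · unfold rotate
    rw [Finset.sum_comm]
    refine Finset.sum_congr rfl fun a _ => Finset.sum_congr rfl fun b _ =>
      Finset.sum_congr rfl fun c _ => Finset.sum_congr rfl fun d _ => ?_
    rw [h₁ b a c d]
    ring
  · have hcomm : ∀ F : Fin 3 → Fin 3 → Fin 3 → Fin 3 → ℝ,
        ∑ a, ∑ b, ∑ c, ∑ d, F a b c d = ∑ c, ∑ d, ∑ a, ∑ b, F a b c d := by
      intro F
      calc ∑ a, ∑ b, ∑ c, ∑ d, F a b c d = ∑ a, ∑ c, ∑ b, ∑ d, F a b c d :=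
            Finset.sum_congr rfl fun a _ => Finset.sum_comm
        _ = ∑ c, ∑ a, ∑ b, ∑ d, F a b c d := Finset.sum_comm
        _ = ∑ c, ∑ a, ∑ d, ∑ b, F a b c d :=
            Finset.sum_congr rfl fun c _ => Finset.sum_congr rfl fun a _ => Finset.sum_comm
        _ = ∑ c, ∑ d, ∑ a, ∑ b, F a b c d :=
            Finset.sum_congr rfl fun c _ => Finset.sum_comm
    unfold rotate
    rw [hcomm]
    refine Finset.sum_congr rfl fun c _ => Finset.sum_congr rfl fun d _ =>
      Finset.sum_congr rfl fun a _ => Finset.sum_congr rfl fun b _ => ?_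
    rw [h₂ a b c d]
    ring

/-- The action of a matrix on the space of elasticity tensors. -/
def rotateElasticity (O : Matrix (Fin 3) (Fin 3) ℝ) (C : elasticitySpace) : elasticitySpace :=
  ⟨rotate O C, rotate_mem O C.2⟩

/-- A quadratic invariant of the elasticity tensor: a function of the form
`f_{ijklpqrs} C_{ijkl} C_{pqrs}`, with constant numerical coefficients `f_{ijklpqrs}`, whose value
does not change when `C` is rotated by an element of `SO(3)`. -/
def IsQuadraticInvariant (I : elasticitySpace → ℝ) : Prop :=
  (∃ f : Fin 3 → Fin 3 → Fin 3 → Fin 3 → Fin 3 → Fin 3 → Fin 3 → Fin 3 → ℝ,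
    ∀ C : elasticitySpace, I C = ∑ i, ∑ j, ∑ k, ∑ l, ∑ p, ∑ q, ∑ r, ∑ s,
      f i j k l p q r s * C.1 i j k l * C.1 p q r s) ∧
  ∀ O ∈ Matrix.specialOrthogonalGroup (Fin 3) ℝ, ∀ C : elasticitySpace,
    I (rotateElasticity O C) = I C

/-- The Euclidean metric tensor `g_{ij}` in rectangular coordinates. -/
def metric : Tensor2 := fun i j => if i = j then 1 else 0

/-- The Levi-Civita symbol `ε_{ijk}`: the determinant with rows the basis vectors
`e_i, e_j, e_k`. -/
def leviCivita (i j k : Fin 3) : ℝ :=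
  Matrix.det (Matrix.of ![metric i, metric j, metric k])

/-- The Cauchy part `S_{ijkl} = C_{(ijkl)}` of an elasticity tensor. -/
noncomputable def cauchyPart (C : elasticitySpace) : Tensor4 := fun i j k l =>
  (1 / 3) * (C.1 i j k l + C.1 i k l j + C.1 i l j k)

/-- The non-Cauchy part `A_{ijkl} = C_{ijkl} - C_{(ijkl)}`. -/
noncomputable def nonCauchyPart (C : elasticitySpace) : Tensor4 := fun i j k l =>
  C.1 i j k l - cauchyPart C i j k l

/-- The contraction `S_{ij} = g_{kl} S_{ijkl}` of the Cauchy part. -/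
noncomputable def cauchyTrace (C : elasticitySpace) : Tensor2 := fun i j =>
  ∑ k, ∑ l, metric k l * cauchyPart C i j k l

/-- The scalar `S = g_{ij} S_{ij}`. -/
noncomputable def scalarS (C : elasticitySpace) : ℝ :=
  ∑ i, ∑ j, metric i j * cauchyTrace C i j

/-- The traceless tensor `P_{ij} = S_{ij} - (1/3) S g_{ij}`. -/
noncomputable def tensorP (C : elasticitySpace) : Tensor2 := fun i j =>
  cauchyTrace C i j - (1 / 3) * scalarS C * metric i j

/-- The first part `(1/5) S g_{(ij} g_{kl)}` of the Cauchy part. -/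
noncomputable def cauchyPart₁ (C : elasticitySpace) : Tensor4 := fun i j k l =>
  (1 / 15) * scalarS C *
    (metric i j * metric k l + metric i k * metric j l + metric i l * metric j k)

/-- The second part `(6/7) P_{(ij} g_{kl)}` of the Cauchy part. -/
noncomputable def cauchyPart₂ (C : elasticitySpace) : Tensor4 := fun i j k l =>
  (1 / 7) * (tensorP C i j * metric k l + tensorP C i k * metric j l + tensorP C i l * metric j k
    + tensorP C j k * metric i l + tensorP C j l * metric i k + tensorP C k l * metric i j)

/-- The totally traceless remainder `R_{ijkl}` of the Cauchy part. -/
noncomputable def tensorR (C : elasticitySpace) : Tensor4 := fun i j k l =>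
  cauchyPart C i j k l - cauchyPart₁ C i j k l - cauchyPart₂ C i j k l

/-- `Δ_{mn} = (1/3) ε_{mil} ε_{njk} A_{ijkl}`. -/
noncomputable def tensorDelta (C : elasticitySpace) : Tensor2 := fun m n =>
  (1 / 3) * ∑ i, ∑ j, ∑ k, ∑ l, leviCivita m i l * leviCivita n j k * nonCauchyPart C i j k l

/-- The scalar `A = g_{mn} Δ_{mn}`. -/
noncomputable def scalarA (C : elasticitySpace) : ℝ :=
  ∑ m, ∑ n, metric m n * tensorDelta C m n

/-- The traceless tensor `Q_{ij} = Δ_{ij} - (1/3) A g_{ij}`. -/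
noncomputable def tensorQ (C : elasticitySpace) : Tensor2 := fun i j =>
  tensorDelta C i j - (1 / 3) * scalarA C * metric i j

/-- Full contraction `X_{ij} Y_{ij}` of second-rank tensors. -/
def inner2 (X Y : Tensor2) : ℝ := ∑ i, ∑ j, X i j * Y i j

/-- Full contraction `X_{ijkl} Y_{ijkl}` of fourth-rank tensors. -/
def inner4 (X Y : Tensor4) : ℝ := ∑ i, ∑ j, ∑ k, ∑ l, X i j k l * Y i j k l

/-- The seven invariants
`S², A S, A², P_{ij} P_{ij}, P_{ij} Q_{ij}, Q_{ij} Q_{ij}, R_{ijkl} R_{ijkl}`, in this order. -/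
noncomputable def Z : Fin 7 → elasticitySpace → ℝ :=
  ![fun C => scalarS C ^ 2,
    fun C => scalarA C * scalarS C,
    fun C => scalarA C ^ 2,
    fun C => inner2 (tensorP C) (tensorP C),
    fun C => inner2 (tensorP C) (tensorQ C),
    fun C => inner2 (tensorQ C) (tensorQ C),
    fun C => inner4 (tensorR C) (tensorR C)]

end Elasticity

/-!
The quadratic invariants of the elasticity tensor form a seven-dimensional space. The argument uses
two families of elasticity tensors attached to a vector of `ℝ³`: the fourth powers
`v_i v_j v_k v_l` (`fourthPower`), and the tensors `X_{ik} X_{jl} + X_{il} X_{jk}`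
(`crossSquare`), where `X` is the antisymmetric matrix of a vector `w`. A rotation acts on these
tensors by acting on the vectors. Together they span the space: by polarization, every symmetrized
decomposable tensor is a combination of them (`symmetrize_decomposable`, `span_eq_top`). Hence a
quadratic form is determined by the values of its polar form on these tensors.

If the quadratic form is invariant, these values can be computed after a rotation that brings the
two vectors involved to `r e₁` and `x e₁ + y e₂` (`exists_rotation`). A half-turn about `e₁` changes
the sign of `y`, so the value is an even polynomial in `y`; expanding it leaves three unknown
coefficients for a pair of fourth powers, two for a mixed pair and two for a pair of `crossSquare`
tensors. So an invariant is determined by seven numbers (`polarValues`,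
`eq_zero_of_polarValues_eq_zero`).

The polar forms of the functions `Z n` take on these tensors values that are polynomials in the
inner products of the vectors (`polar_Z_fourthPower`, `polar_Z_fourthPower_crossSquare`,
`polar_Z_crossSquare`). This shows that the `Z n` are invariant, and that the seven vectors
`polarValues (Z n)` of `ℝ⁷` are linearly independent, hence a basis. Linear independence of the
`Z n` follows, and so does the expansion of every invariant in terms of them.
-/

open Matrix

namespace Elasticity

/-! ### Elasticity tensors attached to vectors -/

/-- The elasticity tensor `v_i v_j v_k v_l`. -/
def fourthPower (v : Fin 3 → ℝ) : elasticitySpace :=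
  ⟨fun i j k l => v i * v j * v k * v l, fun i j k l => by ring, fun i j k l => by ring⟩

/-- The matrix of the cross product with `w`, up to sign. -/
def crossMatrix (w : Fin 3 → ℝ) : Matrix (Fin 3) (Fin 3) ℝ :=
  !![0, w 2, -w 1; -w 2, 0, w 0; w 1, -w 0, 0]

theorem crossMatrix_swap (w : Fin 3 → ℝ) (i j : Fin 3) :
    crossMatrix w j i = -crossMatrix w i j := by
  fin_cases i <;> fin_cases j <;> simp [crossMatrix]

theorem crossMatrix_add (v w : Fin 3 → ℝ) (i j : Fin 3) :
    crossMatrix (v + w) i j = crossMatrix v i j + crossMatrix w i j := by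
  fin_cases i <;> fin_cases j <;> simp [crossMatrix] <;> ring

theorem crossMatrix_smul (r : ℝ) (w : Fin 3 → ℝ) (i j : Fin 3) :
    crossMatrix (r • w) i j = r * crossMatrix w i j := by
  fin_cases i <;> fin_cases j <;> simp [crossMatrix]

theorem crossMatrix_crossProduct (a b : Fin 3 → ℝ) (i j : Fin 3) :
    crossMatrix (a ⨯₃ b) i j = a i * b j - a j * b i := by
  fin_cases i <;> fin_cases j <;> simp [crossMatrix, cross_apply]

/-- The elasticity tensor `X_{ik} X_{jl} + X_{il} X_{jk}`, where `X` is the antisymmetric matrix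
of the vector `w`. It has no Cauchy part. -/
def crossSquare (w : Fin 3 → ℝ) : elasticitySpace :=
  ⟨fun i j k l => crossMatrix w i k * crossMatrix w j l + crossMatrix w i l * crossMatrix w j k,
    fun i j k l => by ring, fun i j k l => by
      simp only [crossMatrix_swap w i k, crossMatrix_swap w j l, crossMatrix_swap w j k,
        crossMatrix_swap w i l]
      ring⟩

theorem fourthPower_smul (r : ℝ) (v : Fin 3 → ℝ) :
    fourthPower (r • v) = r ^ 4 • fourthPower v := by
  ext i j k l
  simp [fourthPower]
  ring

theorem crossSquare_smul (r : ℝ) (w : Fin 3 → ℝ) :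
    crossSquare (r • w) = r ^ 2 • crossSquare w := by
  ext i j k l
  simp [crossSquare, crossMatrix_smul]
  ring

/-- Averaging over a reflection removes the odd powers of `y` from `(x a + y b)^{⊗4}`. -/
theorem fourthPower_add_reflection (x y : ℝ) (a b : Fin 3 → ℝ) :
    fourthPower (x • a + y • b) + fourthPower (x • a - y • b) =
      (2 * x ^ 4 - 2 * x ^ 2 * y ^ 2) • fourthPower a +
      (2 * y ^ 4 - 2 * x ^ 2 * y ^ 2) • fourthPower b +
      (x ^ 2 * y ^ 2) • (fourthPower (a + b) + fourthPower (a - b)) := by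
  ext i j k l
  simp [fourthPower]
  ring

theorem crossSquare_add_reflection (x y : ℝ) (a b : Fin 3 → ℝ) :
    crossSquare (x • a + y • b) + crossSquare (x • a - y • b) =
      (2 * x ^ 2) • crossSquare a + (2 * y ^ 2) • crossSquare b := by
  have h : x • a - y • b = x • a + (-y) • b := by rw [neg_smul, sub_eq_add_neg]
  ext i j k l
  simp [crossSquare, crossMatrix_smul, crossMatrix_add, h, -neg_smul]
  ring

theorem rotateElasticity_fourthPower (O : Matrix (Fin 3) (Fin 3) ℝ) (v : Fin 3 → ℝ) :
    rotateElasticity O (fourthPower v) = fourthPower (O *ᵥ v) := by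
  ext i j k l
  simp only [rotateElasticity, rotate, fourthPower, mulVec, dotProduct, Fin.sum_univ_three]
  ring

/-- A rotation coincides with its cofactor matrix, so it commutes with the passage from a vector to
its antisymmetric matrix. -/
theorem crossMatrix_mulVec {O : Matrix (Fin 3) (Fin 3) ℝ}
    (hO : O ∈ specialOrthogonalGroup (Fin 3) ℝ) (w : Fin 3 → ℝ) :
    crossMatrix (O *ᵥ w) = O * crossMatrix w * Oᵀ := by
  obtain ⟨h₁, h₂⟩ := mem_specialOrthogonalGroup_iff.1 hO
  have h₃ : O.adjugate = Oᵀ := by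
    have h : O * Oᵀ = 1 := (mem_orthogonalGroup_iff _ _).1 h₁
    calc O.adjugate = O.adjugate * (O * Oᵀ) := by rw [h, mul_one]
      _ = Oᵀ := by rw [← mul_assoc, adjugate_mul, h₂, one_smul, one_mul]
  have hcof : ∀ i j, O i j = O.adjugate j i := fun i j => by rw [h₃, transpose_apply]
  rw [adjugate_fin_three] at hcof
  have h00 := hcof 0 0
  have h01 := hcof 0 1
  have h02 := hcof 0 2
  have h10 := hcof 1 0
  have h11 := hcof 1 1
  have h12 := hcof 1 2
  have h20 := hcof 2 0
  have h21 := hcof 2 1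
  have h22 := hcof 2 2
  simp at h00 h01 h02 h10 h11 h12 h20 h21 h22
  ext i j
  fin_cases i <;> fin_cases j <;>
    simp [crossMatrix, mul_apply, mulVec, dotProduct, Fin.sum_univ_three]
  · ring
  · linear_combination w 0 * h20 + w 1 * h21 + w 2 * h22
  · linear_combination -(w 0 * h10 + w 1 * h11 + w 2 * h12)
  · linear_combination -(w 0 * h20 + w 1 * h21 + w 2 * h22)
  · ring
  · linear_combination w 0 * h00 + w 1 * h01 + w 2 * h02
  · linear_combination w 0 * h10 + w 1 * h11 + w 2 * h12
  · linear_combination -(w 0 * h00 + w 1 * h01 + w 2 * h02)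
  · ring

theorem rotateElasticity_crossSquare {O : Matrix (Fin 3) (Fin 3) ℝ}
    (hO : O ∈ specialOrthogonalGroup (Fin 3) ℝ) (w : Fin 3 → ℝ) :
    rotateElasticity O (crossSquare w) = crossSquare (O *ᵥ w) := by
  ext i j k l
  simp only [rotateElasticity, rotate, crossSquare, crossMatrix_mulVec hO, mul_apply,
    transpose_apply, Fin.sum_univ_three]
  ring

/-! ### The tensors of vectors span the elasticity tensors -/

/-- The projection of fourth-rank tensors onto elasticity tensors, by averaging over the symmetries
`C_{ijkl} = C_{jikl} = C_{klij}`. -/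
noncomputable def symmetrize : Tensor4 →ₗ[ℝ] elasticitySpace where
  toFun T := ⟨fun i j k l => (1 / 8) * (T i j k l + T j i k l + T i j l k + T j i l k +
      T k l i j + T k l j i + T l k i j + T l k j i),
    fun i j k l => by ring, fun i j k l => by ring⟩
  map_add' T U := by
    ext i j k l
    simp
    ring
  map_smul' r T := by
    ext i j k l
    simp
    ring

theorem symmetrize_coe (C : elasticitySpace) : symmetrize C.1 = C := by
  obtain ⟨C, h₁, h₂⟩ := C
  ext i j k l
  simp only [symmetrize, LinearMap.coe_mk, AddHom.coe_mk]
  have h₃ : ∀ i j k l, C i j l k = C i j k l := fun i j k l => by rw [h₂, h₁, h₂]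
  rw [h₁ j i k l, h₁ j i l k, h₃ i j k l, h₃ k l i j, h₁ l k i j, h₁ l k j i, h₃ k l i j,
    h₂ k l i j]
  ring

/-- The decomposable tensor `a_i b_j c_k d_l`. -/
def decomposable (a b c d : Fin 3 → ℝ) : Tensor4 := fun i j k l => a i * b j * c k * d l

/-- The standard basis of the fourth-rank tensors. -/
def basisTensor (i j k l : Fin 3) : Tensor4 :=
  decomposable (Pi.single i 1) (Pi.single j 1) (Pi.single k 1) (Pi.single l 1)

theorem sum_smul_basisTensor (T : Tensor4) :
    T = ∑ i, ∑ j, ∑ k, ∑ l, T i j k l • basisTensor i j k l := by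
  ext i j k l
  simp [Finset.sum_apply, basisTensor, decomposable, Pi.single_apply]

theorem sum_smul_symmetrize (C : elasticitySpace) :
    C = ∑ i, ∑ j, ∑ k, ∑ l, C.1 i j k l • symmetrize (basisTensor i j k l) := by
  conv_lhs => rw [← symmetrize_coe C, sum_smul_basisTensor C.1]
  simp only [map_sum, map_smul]

/-- A symmetrized decomposable tensor is the sum of its totally symmetric part, which is a
combination of fourth powers by polarization, and of a part built from cross products. -/
theorem symmetrize_decomposable (a b c d : Fin 3 → ℝ) :
    symmetrize (decomposable a b c d) =
      (1 / 192 : ℝ) • (fourthPower (a + b + c + d) - fourthPower (a + b + c - d)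
        - fourthPower (a + b - c + d) + fourthPower (a + b - c - d)
        - fourthPower (a - b + c + d) + fourthPower (a - b + c - d)
        + fourthPower (a - b - c + d) - fourthPower (a - b - c - d))
      + (1 / 24 : ℝ) • (crossSquare (a ⨯₃ c + b ⨯₃ d) - crossSquare (a ⨯₃ c)
        - crossSquare (b ⨯₃ d) + crossSquare (a ⨯₃ d + b ⨯₃ c) - crossSquare (a ⨯₃ d)
        - crossSquare (b ⨯₃ c)) := by
  ext i j k l
  simp [symmetrize, decomposable, fourthPower, crossSquare, crossMatrix_add,
    crossMatrix_crossProduct]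
  ring

theorem span_eq_top :
    Submodule.span ℝ (Set.range fourthPower ∪ Set.range crossSquare) = ⊤ := by
  have h₁ : ∀ v, fourthPower v ∈ Submodule.span ℝ (Set.range fourthPower ∪ Set.range crossSquare) :=
    fun v => Submodule.subset_span (Or.inl ⟨v, rfl⟩)
  have h₂ : ∀ w, crossSquare w ∈ Submodule.span ℝ (Set.range fourthPower ∪ Set.range crossSquare) :=
    fun w => Submodule.subset_span (Or.inr ⟨w, rfl⟩)
  refine eq_top_iff.2 fun C _ => ?_
  rw [sum_smul_symmetrize C]
  refine Submodule.sum_mem _ fun i _ => Submodule.sum_mem _ fun j _ =>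
    Submodule.sum_mem _ fun k _ => Submodule.sum_mem _ fun l _ => Submodule.smul_mem _ _ ?_
  rw [basisTensor, symmetrize_decomposable]
  refine Submodule.add_mem _ (Submodule.smul_mem _ _ ?_) (Submodule.smul_mem _ _ ?_)
  · apply_rules [Submodule.add_mem, Submodule.sub_mem]
  · apply_rules [Submodule.add_mem, Submodule.sub_mem]

/-- A bilinear form on elasticity tensors is determined by its values on the tensors of vectors. -/
theorem bilinForm_ext {B B' : LinearMap.BilinForm ℝ elasticitySpace}
    (h₁ : ∀ u v, B (fourthPower u) (fourthPower v) = B' (fourthPower u) (fourthPower v))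
    (h₂ : ∀ u w, B (fourthPower u) (crossSquare w) = B' (fourthPower u) (crossSquare w))
    (h₃ : ∀ w u, B (crossSquare w) (fourthPower u) = B' (crossSquare w) (fourthPower u))
    (h₄ : ∀ w z, B (crossSquare w) (crossSquare z) = B' (crossSquare w) (crossSquare z)) :
    B = B' := by
  refine LinearMap.ext_on span_eq_top ?_
  rintro _ (⟨u, rfl⟩ | ⟨w, rfl⟩) <;> refine LinearMap.ext_on span_eq_top ?_
  · rintro _ (⟨v, rfl⟩ | ⟨w, rfl⟩)
    exacts [h₁ u v, h₂ u w]
  · rintro _ (⟨v, rfl⟩ | ⟨z, rfl⟩)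
    exacts [h₃ w v, h₄ w z]

/-! ### Quadratic forms as diagonals of bilinear forms -/

theorem rotateElasticity_add (O : Matrix (Fin 3) (Fin 3) ℝ) (C D : elasticitySpace) :
    rotateElasticity O (C + D) = rotateElasticity O C + rotateElasticity O D := by
  ext i j k l
  simp [rotateElasticity, rotate, mul_add, Finset.sum_add_distrib]

theorem rotateElasticity_smul (O : Matrix (Fin 3) (Fin 3) ℝ) (r : ℝ) (C : elasticitySpace) :
    rotateElasticity O (r • C) = r • rotateElasticity O C := by
  ext i j k l
  simp [rotateElasticity, rotate, mul_left_comm, Finset.mul_sum]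

/-- The action of a matrix on elasticity tensors, as a linear map. -/
def rotateLinear (O : Matrix (Fin 3) (Fin 3) ℝ) : elasticitySpace →ₗ[ℝ] elasticitySpace where
  toFun := rotateElasticity O
  map_add' := rotateElasticity_add O
  map_smul' := rotateElasticity_smul O

@[simp]
theorem rotateLinear_apply (O : Matrix (Fin 3) (Fin 3) ℝ) (C : elasticitySpace) :
    rotateLinear O C = rotateElasticity O C := rfl

theorem linearMap_eq_sum {M : Type*} [AddCommGroup M] [Module ℝ M] (φ : elasticitySpace →ₗ[ℝ] M)
    (C : elasticitySpace) :
    φ C = ∑ i, ∑ j, ∑ k, ∑ l, C.1 i j k l • φ (symmetrize (basisTensor i j k l)) := by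
  conv_lhs => rw [sum_smul_symmetrize C]
  simp only [map_sum, map_smul]

/-- The linear functional `C ↦ C_{ijkl}`. -/
def component (i j k l : Fin 3) : elasticitySpace →ₗ[ℝ] ℝ where
  toFun C := C.1 i j k l
  map_add' _ _ := rfl
  map_smul' _ _ := rfl

@[simp]
theorem component_apply (i j k l : Fin 3) (C : elasticitySpace) :
    component i j k l C = C.1 i j k l := rfl

/-- The functions `f_{ijklpqrs} C_{ijkl} C_{pqrs}` are the diagonals of the bilinear forms. -/
theorem exists_coeff_iff_exists_bilinForm (I : elasticitySpace → ℝ) :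
    (∃ f : Fin 3 → Fin 3 → Fin 3 → Fin 3 → Fin 3 → Fin 3 → Fin 3 → Fin 3 → ℝ,
      ∀ C : elasticitySpace, I C = ∑ i, ∑ j, ∑ k, ∑ l, ∑ p, ∑ q, ∑ r, ∑ s,
        f i j k l p q r s * C.1 i j k l * C.1 p q r s) ↔
    ∃ B : LinearMap.BilinForm ℝ elasticitySpace, ∀ C, I C = B C C := by
  constructor
  · rintro ⟨f, hf⟩
    refine ⟨∑ i, ∑ j, ∑ k, ∑ l, ∑ p, ∑ q, ∑ r, ∑ s,
      (f i j k l p q r s • component i j k l).smulRight (component p q r s), fun C => ?_⟩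
    simp only [hf, LinearMap.sum_apply, LinearMap.smulRight_apply, LinearMap.smul_apply,
      component_apply, smul_eq_mul]
  · rintro ⟨B, hB⟩
    refine ⟨fun i j k l p q r s =>
      B (symmetrize (basisTensor i j k l)) (symmetrize (basisTensor p q r s)), fun C => ?_⟩
    rw [hB, linearMap_eq_sum B C]
    simp only [LinearMap.sum_apply, LinearMap.smul_apply, smul_eq_mul]
    refine Finset.sum_congr rfl fun i _ => Finset.sum_congr rfl fun j _ =>
      Finset.sum_congr rfl fun k _ => Finset.sum_congr rfl fun l _ => ?_
    rw [linearMap_eq_sum (B (symmetrize (basisTensor i j k l))) C]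
    simp only [Finset.mul_sum, smul_eq_mul]
    refine Finset.sum_congr rfl fun p _ => Finset.sum_congr rfl fun q _ =>
      Finset.sum_congr rfl fun r _ => Finset.sum_congr rfl fun s _ => ?_
    ring

theorem polar_diagonal {I : elasticitySpace → ℝ} {B : LinearMap.BilinForm ℝ elasticitySpace}
    (hB : ∀ C, I C = B C C) (C D : elasticitySpace) :
    QuadraticMap.polar I C D = B C D + B D C := by
  simp only [QuadraticMap.polar, hB, map_add, LinearMap.add_apply]
  ring

theorem polar_rotateElasticity {I : elasticitySpace → ℝ} (hI : IsQuadraticInvariant I)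
    {O : Matrix (Fin 3) (Fin 3) ℝ} (hO : O ∈ specialOrthogonalGroup (Fin 3) ℝ)
    (C D : elasticitySpace) :
    QuadraticMap.polar I (rotateElasticity O C) (rotateElasticity O D) =
      QuadraticMap.polar I C D := by
  simp only [QuadraticMap.polar, ← rotateElasticity_add, hI.2 O hO]

/-- A quadratic form whose polar form vanishes on the tensors of vectors is zero. -/
theorem eq_zero_of_polar_eq_zero {I : elasticitySpace → ℝ}
    {B : LinearMap.BilinForm ℝ elasticitySpace} (hB : ∀ C, I C = B C C)
    (h₁ : ∀ u v, QuadraticMap.polar I (fourthPower u) (fourthPower v) = 0)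
    (h₂ : ∀ u w, QuadraticMap.polar I (fourthPower u) (crossSquare w) = 0)
    (h₃ : ∀ w z, QuadraticMap.polar I (crossSquare w) (crossSquare z) = 0) (C : elasticitySpace) :
    I C = 0 := by
  simp only [polar_diagonal hB] at h₁ h₂ h₃
  have h : B + B.flip = 0 := by
    refine bilinForm_ext ?_ ?_ ?_ ?_
    · simpa using h₁
    · simpa using h₂
    · intro w u
      simpa [add_comm] using h₂ u w
    · simpa using h₃
  have h' := LinearMap.congr_fun₂ h C C
  simp only [LinearMap.add_apply, LinearMap.BilinForm.flip_apply, LinearMap.zero_apply] at h'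
  rw [hB]
  linarith

/-! ### The linear constituents of an elasticity tensor -/

theorem leviCivita_eq_crossMatrix (i j k : Fin 3) :
    leviCivita i j k = crossMatrix (Pi.single i 1) j k := by
  fin_cases i <;> fin_cases j <;> fin_cases k <;>
    simp [leviCivita, det_fin_three, metric, crossMatrix]

theorem isLinearMap_cauchyPart : IsLinearMap ℝ cauchyPart where
  map_add C D := by
    ext i j k l
    simp [cauchyPart]
    ring
  map_smul r C := by
    ext i j k l
    simp [cauchyPart]
    ring

theorem isLinearMap_cauchyTrace : IsLinearMap ℝ cauchyTrace where
  map_add C D := by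
    ext i j
    simp [cauchyTrace, isLinearMap_cauchyPart.map_add, mul_add, Finset.sum_add_distrib]
  map_smul r C := by
    ext i j
    simp [cauchyTrace, isLinearMap_cauchyPart.map_smul, mul_left_comm, Finset.mul_sum]

theorem isLinearMap_scalarS : IsLinearMap ℝ scalarS where
  map_add C D := by
    simp [scalarS, isLinearMap_cauchyTrace.map_add, mul_add, Finset.sum_add_distrib]
  map_smul r C := by
    simp [scalarS, isLinearMap_cauchyTrace.map_smul, mul_left_comm, Finset.mul_sum]

theorem isLinearMap_tensorP : IsLinearMap ℝ tensorP where
  map_add C D := by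
    ext i j
    simp [tensorP, isLinearMap_cauchyTrace.map_add, isLinearMap_scalarS.map_add]
    ring
  map_smul r C := by
    ext i j
    simp [tensorP, isLinearMap_cauchyTrace.map_smul, isLinearMap_scalarS.map_smul]
    ring

theorem isLinearMap_tensorR : IsLinearMap ℝ tensorR where
  map_add C D := by
    ext i j k l
    simp [tensorR, cauchyPart₁, cauchyPart₂, isLinearMap_cauchyPart.map_add,
      isLinearMap_scalarS.map_add, isLinearMap_tensorP.map_add]
    ring
  map_smul r C := by
    ext i j k l
    simp [tensorR, cauchyPart₁, cauchyPart₂, isLinearMap_cauchyPart.map_smul,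
      isLinearMap_scalarS.map_smul, isLinearMap_tensorP.map_smul]
    ring

theorem isLinearMap_tensorDelta : IsLinearMap ℝ tensorDelta where
  map_add C D := by
    ext m n
    simp [tensorDelta, nonCauchyPart, isLinearMap_cauchyPart.map_add, mul_add,
      Finset.sum_add_distrib, add_sub_add_comm]
  map_smul r C := by
    ext m n
    simp [tensorDelta, nonCauchyPart, isLinearMap_cauchyPart.map_smul, mul_left_comm,
      Finset.mul_sum, ← mul_sub]

theorem isLinearMap_scalarA : IsLinearMap ℝ scalarA where
  map_add C D := by
    simp [scalarA, isLinearMap_tensorDelta.map_add, mul_add, Finset.sum_add_distrib]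
  map_smul r C := by
    simp [scalarA, isLinearMap_tensorDelta.map_smul, mul_left_comm, Finset.mul_sum]

theorem isLinearMap_tensorQ : IsLinearMap ℝ tensorQ where
  map_add C D := by
    ext i j
    simp [tensorQ, isLinearMap_tensorDelta.map_add, isLinearMap_scalarA.map_add]
    ring
  map_smul r C := by
    ext i j
    simp [tensorQ, isLinearMap_tensorDelta.map_smul, isLinearMap_scalarA.map_smul]
    ring

/-! ### Values of the constituents on the tensors of vectors -/

theorem cauchyPart_fourthPower (v : Fin 3 → ℝ) :
    cauchyPart (fourthPower v) = (fourthPower v).1 := by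
  ext i j k l
  simp [cauchyPart, fourthPower]
  ring

theorem cauchyPart_crossSquare (w : Fin 3 → ℝ) : cauchyPart (crossSquare w) = 0 := by
  ext i j k l
  simp [cauchyPart, crossSquare, crossMatrix_swap w j k, crossMatrix_swap w j l,
    crossMatrix_swap w k l]

theorem cauchyTrace_fourthPower (v : Fin 3 → ℝ) (i j : Fin 3) :
    cauchyTrace (fourthPower v) i j = (v ⬝ᵥ v) * (v i * v j) := by
  simp [cauchyTrace, cauchyPart_fourthPower, metric]
  simp [fourthPower, dotProduct, Fin.sum_univ_three]
  ring

theorem scalarS_fourthPower (v : Fin 3 → ℝ) : scalarS (fourthPower v) = (v ⬝ᵥ v) ^ 2 := by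
  simp [scalarS, cauchyTrace_fourthPower, metric, dotProduct, ← Finset.mul_sum, sq]

theorem tensorP_fourthPower (v : Fin 3 → ℝ) (i j : Fin 3) :
    tensorP (fourthPower v) i j = (v ⬝ᵥ v) * (v i * v j - 1 / 3 * (v ⬝ᵥ v) * metric i j) := by
  simp only [tensorP, scalarS_fourthPower, cauchyTrace_fourthPower]
  ring

theorem tensorDelta_fourthPower (v : Fin 3 → ℝ) : tensorDelta (fourthPower v) = 0 := by
  ext m n
  simp [tensorDelta, nonCauchyPart, cauchyPart_fourthPower]

theorem scalarA_fourthPower (v : Fin 3 → ℝ) : scalarA (fourthPower v) = 0 := by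
  simp [scalarA, tensorDelta_fourthPower]

theorem tensorQ_fourthPower (v : Fin 3 → ℝ) : tensorQ (fourthPower v) = 0 := by
  ext i j
  simp [tensorQ, tensorDelta_fourthPower, scalarA_fourthPower]

theorem scalarS_crossSquare (w : Fin 3 → ℝ) : scalarS (crossSquare w) = 0 := by
  simp [scalarS, cauchyTrace, cauchyPart_crossSquare]

theorem tensorP_crossSquare (w : Fin 3 → ℝ) : tensorP (crossSquare w) = 0 := by
  ext i j
  simp [tensorP, cauchyTrace, cauchyPart_crossSquare, scalarS_crossSquare]

theorem tensorR_crossSquare (w : Fin 3 → ℝ) : tensorR (crossSquare w) = 0 := by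
  ext i j k l
  simp [tensorR, cauchyPart₁, cauchyPart₂, cauchyPart_crossSquare, scalarS_crossSquare,
    tensorP_crossSquare]

theorem tensorDelta_crossSquare (w : Fin 3 → ℝ) (m n : Fin 3) :
    tensorDelta (crossSquare w) m n = 2 * (w m * w n) := by
  simp only [tensorDelta, nonCauchyPart, cauchyPart_crossSquare, leviCivita_eq_crossMatrix]
  fin_cases m <;> fin_cases n <;> simp [crossSquare, crossMatrix, Fin.sum_univ_three] <;> ring

theorem scalarA_crossSquare (w : Fin 3 → ℝ) : scalarA (crossSquare w) = 2 * (w ⬝ᵥ w) := by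
  simp [scalarA, tensorDelta_crossSquare, metric, dotProduct, ← Finset.mul_sum]

theorem tensorQ_crossSquare (w : Fin 3 → ℝ) (i j : Fin 3) :
    tensorQ (crossSquare w) i j = 2 * (w i * w j - 1 / 3 * (w ⬝ᵥ w) * metric i j) := by
  simp only [tensorQ, scalarA_crossSquare, tensorDelta_crossSquare]
  ring

/-- Contraction of the traceless parts of two squares, up to constant factors. -/
theorem inner2_traceless (r s : ℝ) (u v : Fin 3 → ℝ) :
    inner2 (fun i j => r * (u i * u j - 1 / 3 * (u ⬝ᵥ u) * metric i j))
      (fun i j => s * (v i * v j - 1 / 3 * (v ⬝ᵥ v) * metric i j)) =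
      r * s * ((u ⬝ᵥ v) ^ 2 - 1 / 3 * (u ⬝ᵥ u) * (v ⬝ᵥ v)) := by
  simp [inner2, metric, Fin.sum_univ_three, dotProduct]
  ring

set_option maxHeartbeats 1000000 in
/-- The traceless fourth powers contract to a multiple of the Legendre polynomial of degree four. -/
theorem inner4_tensorR_fourthPower (u v : Fin 3 → ℝ) :
    inner4 (tensorR (fourthPower u)) (tensorR (fourthPower v)) =
      (u ⬝ᵥ v) ^ 4 - 6 / 7 * (u ⬝ᵥ u) * (v ⬝ᵥ v) * (u ⬝ᵥ v) ^ 2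
        + 3 / 35 * (u ⬝ᵥ u) ^ 2 * (v ⬝ᵥ v) ^ 2 := by
  have h : ∀ i j : Fin 3, metric i j = if i = j then 1 else 0 := fun _ _ => rfl
  simp only [inner4, tensorR, cauchyPart₁, cauchyPart₂, scalarS_fourthPower, tensorP_fourthPower,
    cauchyPart_fourthPower]
  simp only [fourthPower, dotProduct, Fin.sum_univ_three, h, Fin.isValue, Fin.reduceEq, if_true,
    if_false]
  ring

/-! ### Rotating a pair of vectors to standard position -/

theorem exists_unit_smul {u : Fin 3 → ℝ} (hu : u ≠ 0) :
    ∃ a : Fin 3 → ℝ, a ⬝ᵥ a = 1 ∧ ∃ r : ℝ, r ≠ 0 ∧ u = r • a := by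
  have h : 0 < u ⬝ᵥ u := by simpa using dotProduct_star_self_pos_iff.2 hu
  have hs : √(u ⬝ᵥ u) ≠ 0 := (Real.sqrt_pos.2 h).ne'
  refine ⟨(√(u ⬝ᵥ u))⁻¹ • u, ?_, √(u ⬝ᵥ u), hs, ?_⟩
  · rw [smul_dotProduct, dotProduct_smul, smul_eq_mul, smul_eq_mul, ← mul_assoc, ← mul_inv,
      Real.mul_self_sqrt h.le, inv_mul_cancel₀ h.ne']
  · rw [smul_smul, mul_inv_cancel₀ hs, one_smul]

theorem exists_unit_orthogonal (a : Fin 3 → ℝ) :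
    ∃ b : Fin 3 → ℝ, b ⬝ᵥ b = 1 ∧ a ⬝ᵥ b = 0 := by
  obtain ⟨c, hc, hac⟩ : ∃ c : Fin 3 → ℝ, c ≠ 0 ∧ a ⬝ᵥ c = 0 := by
    by_cases h : a 0 = 0
    · exact ⟨Pi.single 0 1, by simp, by simp [h]⟩
    · refine ⟨![-a 1, a 0, 0], fun h' => h (by simpa using congrFun h' 1), ?_⟩
      simp [dotProduct, Fin.sum_univ_three]
      ring
  obtain ⟨b, hb, r, hr, rfl⟩ := exists_unit_smul hc
  refine ⟨b, hb, ?_⟩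
  simpa [hr] using hac

theorem exists_orthonormal_pair (u v : Fin 3 → ℝ) :
    ∃ a b : Fin 3 → ℝ, a ⬝ᵥ a = 1 ∧ b ⬝ᵥ b = 1 ∧ a ⬝ᵥ b = 0 ∧
      ∃ r x y : ℝ, u = r • a ∧ v = x • a + y • b := by
  obtain ⟨a, ha, r, hu⟩ : ∃ a : Fin 3 → ℝ, a ⬝ᵥ a = 1 ∧ ∃ r : ℝ, u = r • a := by
    by_cases hu : u = 0
    · exact ⟨Pi.single 0 1, by simp, 0, by simp [hu]⟩
    · obtain ⟨a, ha, r, -, h⟩ := exists_unit_smul hu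
      exact ⟨a, ha, r, h⟩
  by_cases hv : v - (a ⬝ᵥ v) • a = 0
  · obtain ⟨b, hb, hab⟩ := exists_unit_orthogonal a
    exact ⟨a, b, ha, hb, hab, r, a ⬝ᵥ v, 0, hu, by rw [zero_smul, add_zero, ← sub_eq_zero, hv]⟩
  · obtain ⟨b, hb, y, hy, h⟩ := exists_unit_smul hv
    refine ⟨a, b, ha, hb, ?_, r, a ⬝ᵥ v, y, hu, by rw [← h]; abel⟩
    have h' := congrArg (a ⬝ᵥ ·) h
    simp only [dotProduct_sub, dotProduct_smul, ha, smul_eq_mul, mul_one, sub_self] at h'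
    exact (mul_eq_zero.1 h'.symm).resolve_left hy

theorem exists_rotation (u v : Fin 3 → ℝ) :
    ∃ O ∈ specialOrthogonalGroup (Fin 3) ℝ, ∃ r x y : ℝ,
      O *ᵥ u = r • Pi.single 0 1 ∧ O *ᵥ v = x • Pi.single 0 1 + y • Pi.single 1 1 := by
  obtain ⟨a, b, ha, hb, hab, r, x, y, rfl, rfl⟩ := exists_orthonormal_pair u v
  have hc : (a ⨯₃ b) ⬝ᵥ (a ⨯₃ b) = 1 := by
    rw [cross_dot_cross, ha, hb, hab, dotProduct_comm b a, hab]
    norm_num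
  have hca : (a ⨯₃ b) ⬝ᵥ a = 0 := by rw [dotProduct_comm, dot_self_cross]
  have hcb : (a ⨯₃ b) ⬝ᵥ b = 0 := by rw [dotProduct_comm, dot_cross_self]
  have hba : b ⬝ᵥ a = 0 := by rw [dotProduct_comm, hab]
  refine ⟨of ![a, b, a ⨯₃ b], mem_specialOrthogonalGroup_iff.2 ⟨?_, ?_⟩, r, x, y, ?_, ?_⟩
  · rw [mem_orthogonalGroup_iff]
    ext i j
    change ![a, b, a ⨯₃ b] i ⬝ᵥ ![a, b, a ⨯₃ b] j = _
    fin_cases i <;> fin_cases j <;> simp [ha, hb, hab, hba, hc, hca, hcb]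
  · change det ![a, b, a ⨯₃ b] = 1
    rw [← triple_product_eq_det, triple_product_permutation, triple_product_permutation, hc]
  · ext i
    change ![a, b, a ⨯₃ b] i ⬝ᵥ _ = _
    fin_cases i <;> simp [ha, hba, hca]
  · ext i
    change ![a, b, a ⨯₃ b] i ⬝ᵥ _ = _
    fin_cases i <;> simp [ha, hb, hab, hba, hca, hcb]

/-- The half-turn about the first axis reverses the second coordinate. -/
theorem exists_halfTurn :
    ∃ O ∈ specialOrthogonalGroup (Fin 3) ℝ, ∀ x y : ℝ,
      O *ᵥ (x • Pi.single 0 1 + y • Pi.single 1 1) = x • Pi.single 0 1 - y • Pi.single 1 1 := by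
  refine ⟨diagonal ![1, -1, -1], mem_specialOrthogonalGroup_iff.2 ⟨?_, ?_⟩, fun x y => ?_⟩
  · rw [mem_orthogonalGroup_iff]
    ext i j
    fin_cases i <;> fin_cases j <;> simp
  · simp [det_diagonal, Fin.prod_univ_three]
  · ext i
    fin_cases i <;> simp [mulVec_diagonal]

/-! ### A quadratic invariant is determined by seven numbers -/

/-- The values of the polar form at seven pairs of tensors of coordinate vectors. -/
noncomputable def polarValues : (elasticitySpace → ℝ) →ₗ[ℝ] (Fin 7 → ℝ) where
  toFun I :=
    ![QuadraticMap.polar I (fourthPower (Pi.single 0 1)) (fourthPower (Pi.single 0 1)),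
      QuadraticMap.polar I (fourthPower (Pi.single 0 1)) (fourthPower (Pi.single 1 1)),
      QuadraticMap.polar I (fourthPower (Pi.single 0 1))
        (fourthPower (Pi.single 0 1 + Pi.single 1 1)),
      QuadraticMap.polar I (fourthPower (Pi.single 0 1)) (crossSquare (Pi.single 0 1)),
      QuadraticMap.polar I (fourthPower (Pi.single 0 1)) (crossSquare (Pi.single 1 1)),
      QuadraticMap.polar I (crossSquare (Pi.single 0 1)) (crossSquare (Pi.single 0 1)),
      QuadraticMap.polar I (crossSquare (Pi.single 0 1)) (crossSquare (Pi.single 1 1))]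
  map_add' I J := by
    ext n
    fin_cases n <;> simp [QuadraticMap.polar_add]
  map_smul' r I := by
    ext n
    fin_cases n <;> simp [QuadraticMap.polar_smul]

theorem eq_zero_of_polarValues_eq_zero {I : elasticitySpace → ℝ} (hI : IsQuadraticInvariant I)
    (h : polarValues I = 0) (C : elasticitySpace) : I C = 0 := by
  obtain ⟨B, hB⟩ := (exists_coeff_iff_exists_bilinForm I).1 hI.1
  -- The polar form of `I`, as a bilinear form.
  obtain ⟨P, hP⟩ : ∃ P : LinearMap.BilinForm ℝ elasticitySpace,
      ∀ C D, P C D = QuadraticMap.polar I C D :=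
    ⟨B + B.flip, fun C D => by simp [polar_diagonal hB]⟩
  have hrot : ∀ O ∈ specialOrthogonalGroup (Fin 3) ℝ, ∀ C D,
      P (rotateElasticity O C) (rotateElasticity O D) = P C D := fun O hO C D => by
    rw [hP, hP, polar_rotateElasticity hI hO]
  obtain ⟨T, hT, hTxy⟩ := exists_halfTurn
  have hTe : T *ᵥ Pi.single 0 1 = Pi.single 0 1 := by simpa using hTxy 1 0
  have h' := fun n => congrFun h n
  simp only [polarValues, LinearMap.coe_mk, AddHom.coe_mk, ← hP] at h'
  have h0 := h' 0
  have h1 := h' 1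
  have h2 := h' 2
  have h3 := h' 3
  have h4 := h' 4
  have h5 := h' 5
  have h6 := h' 6
  simp at h0 h1 h2 h3 h4 h5 h6
  have h2' : P (fourthPower (Pi.single 0 1)) (fourthPower (Pi.single 0 1 - Pi.single 1 1)) = 0 := by
    have := hrot T hT (fourthPower (Pi.single 0 1)) (fourthPower (Pi.single 0 1 + Pi.single 1 1))
    have hT1 := hTxy 1 1
    rw [one_smul, one_smul] at hT1
    rwa [rotateElasticity_fourthPower, rotateElasticity_fourthPower, hTe, hT1, h2] at this
  -- A half-turn shows that `P` takes the same value on a vector of the coordinate plane and on its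
  -- mirror image, so only the even part matters.
  have hpp : ∀ x y : ℝ, P (fourthPower (Pi.single 0 1))
      (fourthPower (x • Pi.single 0 1 + y • Pi.single 1 1)) = 0 := fun x y => by
    have e₁ := hrot T hT (fourthPower (Pi.single 0 1))
      (fourthPower (x • Pi.single 0 1 + y • Pi.single 1 1))
    rw [rotateElasticity_fourthPower, rotateElasticity_fourthPower, hTe, hTxy] at e₁
    have e₂ := congrArg (P (fourthPower (Pi.single 0 1)))
      (fourthPower_add_reflection x y (Pi.single 0 1) (Pi.single 1 1))
    simp only [map_add, map_smul, h0, h1, h2, h2', smul_zero, add_zero] at e₂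
    linarith
  have hpc : ∀ x y : ℝ, P (fourthPower (Pi.single 0 1))
      (crossSquare (x • Pi.single 0 1 + y • Pi.single 1 1)) = 0 := fun x y => by
    have e₁ := hrot T hT (fourthPower (Pi.single 0 1))
      (crossSquare (x • Pi.single 0 1 + y • Pi.single 1 1))
    rw [rotateElasticity_fourthPower, rotateElasticity_crossSquare hT, hTe, hTxy] at e₁
    have e₂ := congrArg (P (fourthPower (Pi.single 0 1)))
      (crossSquare_add_reflection x y (Pi.single 0 1) (Pi.single 1 1))
    simp only [map_add, map_smul, h3, h4, smul_zero, add_zero] at e₂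
    linarith
  have hcc : ∀ x y : ℝ, P (crossSquare (Pi.single 0 1))
      (crossSquare (x • Pi.single 0 1 + y • Pi.single 1 1)) = 0 := fun x y => by
    have e₁ := hrot T hT (crossSquare (Pi.single 0 1))
      (crossSquare (x • Pi.single 0 1 + y • Pi.single 1 1))
    rw [rotateElasticity_crossSquare hT, rotateElasticity_crossSquare hT, hTe, hTxy] at e₁
    have e₂ := congrArg (P (crossSquare (Pi.single 0 1)))
      (crossSquare_add_reflection x y (Pi.single 0 1) (Pi.single 1 1))
    simp only [map_add, map_smul, h5, h6, smul_zero, add_zero] at e₂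
    linarith
  refine eq_zero_of_polar_eq_zero hB (fun u v => ?_) (fun u v => ?_) (fun u v => ?_) C <;>
    obtain ⟨O, hO, r, x, y, hu, hv⟩ := exists_rotation u v <;> rw [← hP, ← hrot O hO]
  · rw [rotateElasticity_fourthPower, rotateElasticity_fourthPower, hu, hv, fourthPower_smul,
      map_smul, LinearMap.smul_apply, hpp, smul_zero]
  · rw [rotateElasticity_fourthPower, rotateElasticity_crossSquare hO, hu, hv, fourthPower_smul,
      map_smul, LinearMap.smul_apply, hpc, smul_zero]
  · rw [rotateElasticity_crossSquare hO, rotateElasticity_crossSquare hO, hu, hv, crossSquare_smul,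
      map_smul, LinearMap.smul_apply, hcc, smul_zero]

/-! ### The seven invariants -/

/-- Full contraction of second-rank tensors, as a bilinear form. -/
def inner2Form : LinearMap.BilinForm ℝ Tensor2 :=
  LinearMap.mk₂ ℝ inner2
    (fun X Y W => by simp [inner2, add_mul, Finset.sum_add_distrib])
    (fun r X Y => by simp [inner2, mul_assoc, Finset.mul_sum])
    (fun X Y W => by simp [inner2, mul_add, Finset.sum_add_distrib])
    (fun r X Y => by simp [inner2, mul_left_comm, Finset.mul_sum])

/-- Full contraction of fourth-rank tensors, as a bilinear form. -/
def inner4Form : LinearMap.BilinForm ℝ Tensor4 :=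
  LinearMap.mk₂ ℝ inner4
    (fun X Y W => by simp [inner4, add_mul, Finset.sum_add_distrib])
    (fun r X Y => by simp [inner4, mul_assoc, Finset.mul_sum])
    (fun X Y W => by simp [inner4, mul_add, Finset.sum_add_distrib])
    (fun r X Y => by simp [inner4, mul_left_comm, Finset.mul_sum])

@[simp]
theorem inner2Form_apply (X Y : Tensor2) : inner2Form X Y = inner2 X Y := rfl

@[simp]
theorem inner4Form_apply (X Y : Tensor4) : inner4Form X Y = inner4 X Y := rfl

@[simp]
theorem inner2_zero_right (X : Tensor2) : inner2 X 0 = 0 := by simp [inner2]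

@[simp]
theorem inner4_zero_right (X : Tensor4) : inner4 X 0 = 0 := by simp [inner4]

/-- Bilinear forms whose diagonals are the functions `Z n`. -/
noncomputable def bilinZ : Fin 7 → LinearMap.BilinForm ℝ elasticitySpace :=
  let S := isLinearMap_scalarS.mk' scalarS
  let A := isLinearMap_scalarA.mk' scalarA
  let P := isLinearMap_tensorP.mk' tensorP
  let Q := isLinearMap_tensorQ.mk' tensorQ
  let R := isLinearMap_tensorR.mk' tensorR
  ![(LinearMap.mul ℝ ℝ).compl₁₂ S S, (LinearMap.mul ℝ ℝ).compl₁₂ A S,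
    (LinearMap.mul ℝ ℝ).compl₁₂ A A, inner2Form.compl₁₂ P P, inner2Form.compl₁₂ P Q,
    inner2Form.compl₁₂ Q Q, inner4Form.compl₁₂ R R]

theorem Z_eq_bilinZ (n : Fin 7) (C : elasticitySpace) : Z n C = bilinZ n C C := by
  fin_cases n <;> simp [Z, bilinZ, sq]

theorem polar_Z_fourthPower (n : Fin 7) (u v : Fin 3 → ℝ) :
    QuadraticMap.polar (Z n) (fourthPower u) (fourthPower v) =
      ![2 * ((u ⬝ᵥ u) ^ 2 * (v ⬝ᵥ v) ^ 2), 0, 0,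
        2 * ((u ⬝ᵥ u) * (v ⬝ᵥ v) * ((u ⬝ᵥ v) ^ 2 - 1 / 3 * (u ⬝ᵥ u) * (v ⬝ᵥ v))), 0, 0,
        2 * ((u ⬝ᵥ v) ^ 4 - 6 / 7 * (u ⬝ᵥ u) * (v ⬝ᵥ v) * (u ⬝ᵥ v) ^ 2
          + 3 / 35 * (u ⬝ᵥ u) ^ 2 * (v ⬝ᵥ v) ^ 2)] n := by
  have hP : ∀ u, tensorP (fourthPower u) = fun i j =>
      (u ⬝ᵥ u) * (u i * u j - 1 / 3 * (u ⬝ᵥ u) * metric i j) := fun u =>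
    funext₂ (tensorP_fourthPower u)
  rw [polar_diagonal (Z_eq_bilinZ n)]
  fin_cases n <;> simp [bilinZ, scalarS_fourthPower, scalarA_fourthPower,
    tensorQ_fourthPower, hP, -one_div, inner2_traceless, inner4_tensorR_fourthPower,
    dotProduct_comm v u] <;> ring

theorem polar_Z_fourthPower_crossSquare (n : Fin 7) (u w : Fin 3 → ℝ) :
    QuadraticMap.polar (Z n) (fourthPower u) (crossSquare w) =
      ![0, 2 * (u ⬝ᵥ u) ^ 2 * (w ⬝ᵥ w), 0, 0,
        2 * (u ⬝ᵥ u) * ((u ⬝ᵥ w) ^ 2 - 1 / 3 * (u ⬝ᵥ u) * (w ⬝ᵥ w)), 0, 0] n := by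
  have hP : ∀ u, tensorP (fourthPower u) = fun i j =>
      (u ⬝ᵥ u) * (u i * u j - 1 / 3 * (u ⬝ᵥ u) * metric i j) := fun u =>
    funext₂ (tensorP_fourthPower u)
  have hQ : ∀ u, tensorQ (crossSquare u) = fun i j =>
      2 * (u i * u j - 1 / 3 * (u ⬝ᵥ u) * metric i j) := fun u =>
    funext₂ (tensorQ_crossSquare u)
  rw [polar_diagonal (Z_eq_bilinZ n)]
  fin_cases n <;> simp [bilinZ, scalarS_fourthPower, scalarA_fourthPower,
    tensorQ_fourthPower, hP, -one_div, inner2_traceless,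
    scalarS_crossSquare, scalarA_crossSquare, tensorP_crossSquare, tensorR_crossSquare, hQ,
    -mul_eq_mul_left_iff, -mul_eq_mul_right_iff] <;> ring

theorem polar_Z_crossSquare (n : Fin 7) (w z : Fin 3 → ℝ) :
    QuadraticMap.polar (Z n) (crossSquare w) (crossSquare z) =
      ![0, 0, 8 * (w ⬝ᵥ w) * (z ⬝ᵥ z), 0, 0,
        8 * ((w ⬝ᵥ z) ^ 2 - 1 / 3 * (w ⬝ᵥ w) * (z ⬝ᵥ z)), 0] n := by
  have hQ : ∀ u, tensorQ (crossSquare u) = fun i j =>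
      2 * (u i * u j - 1 / 3 * (u ⬝ᵥ u) * metric i j) := fun u =>
    funext₂ (tensorQ_crossSquare u)
  rw [polar_diagonal (Z_eq_bilinZ n)]
  fin_cases n <;> simp [bilinZ, -one_div, inner2_traceless,
    scalarS_crossSquare, scalarA_crossSquare, tensorP_crossSquare, tensorR_crossSquare, hQ,
    dotProduct_comm z w] <;> ring

theorem mulVec_dotProduct_mulVec {O : Matrix (Fin 3) (Fin 3) ℝ}
    (hO : O ∈ specialOrthogonalGroup (Fin 3) ℝ) (u v : Fin 3 → ℝ) :
    (O *ᵥ u) ⬝ᵥ (O *ᵥ v) = u ⬝ᵥ v := by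
  have h : Oᵀ * O = 1 := (mem_orthogonalGroup_iff' _ _).1 (mem_specialOrthogonalGroup_iff.1 hO).1
  rw [dotProduct_mulVec, ← mulVec_transpose, mulVec_mulVec, h, one_mulVec]

theorem isQuadraticInvariant_Z (n : Fin 7) : IsQuadraticInvariant (Z n) := by
  refine ⟨(exists_coeff_iff_exists_bilinForm _).2 ⟨bilinZ n, Z_eq_bilinZ n⟩, fun O hO C => ?_⟩
  have hB : ∀ C, Z n (rotateElasticity O C) - Z n C =
      ((bilinZ n).compl₁₂ (rotateLinear O) (rotateLinear O) - bilinZ n) C C := fun C => by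
    simp [Z_eq_bilinZ]
  have hpolar : ∀ C D, QuadraticMap.polar (fun C => Z n (rotateElasticity O C) - Z n C) C D =
      QuadraticMap.polar (Z n) (rotateElasticity O C) (rotateElasticity O D) -
        QuadraticMap.polar (Z n) C D := fun C D => by
    simp only [QuadraticMap.polar, rotateElasticity_add]
    ring
  refine sub_eq_zero.1 (eq_zero_of_polar_eq_zero hB (fun u v => ?_) (fun u w => ?_)
    (fun w z => ?_) C) <;>
    simp only [hpolar, rotateElasticity_fourthPower, rotateElasticity_crossSquare hO,
      polar_Z_fourthPower, polar_Z_fourthPower_crossSquare, polar_Z_crossSquare,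
      mulVec_dotProduct_mulVec hO, sub_self]

/-- The seven numbers attached to the seven invariants form an invertible matrix. -/
theorem linearIndependent_polarValues_Z :
    LinearIndependent ℝ fun n => polarValues (Z n) := by
  rw [Fintype.linearIndependent_iff]
  intro a ha
  have h := fun m => congrFun ha m
  have h0 := h 0
  have h1 := h 1
  have h2 := h 2
  have h3 := h 3
  have h4 := h 4
  have h5 := h 5
  have h6 := h 6
  simp [polarValues, polar_Z_fourthPower, polar_Z_fourthPower_crossSquare, polar_Z_crossSquare,
    Fin.sum_univ_seven] at h0 h1 h2 h3 h4 h5 h6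
  intro n
  fin_cases n <;> simp <;> linarith

end Elasticity

theorem mainTheorem2 :
    (∀ n : Fin 7, Elasticity.IsQuadraticInvariant (Elasticity.Z n)) ∧
    (∀ I : Elasticity.elasticitySpace → ℝ, Elasticity.IsQuadraticInvariant I →
      ∃ a : Fin 7 → ℝ, ∀ C : Elasticity.elasticitySpace,
        I C = ∑ n, a n * Elasticity.Z n C) ∧
    LinearIndependent ℝ Elasticity.Z := by
  refine ⟨Elasticity.isQuadraticInvariant_Z, fun I hI => ?_,
    Elasticity.linearIndependent_polarValues_Z.of_comp Elasticity.polarValues⟩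
  have hspan := Elasticity.linearIndependent_polarValues_Z.span_eq_top_of_card_eq_finrank
    (by simp)
  obtain ⟨a, ha⟩ := (Submodule.mem_span_range_iff_exists_fun ℝ).1
    (hspan ▸ Submodule.mem_top : Elasticity.polarValues I ∈ _)
  refine ⟨a, fun C => ?_⟩
  have hJ : Elasticity.IsQuadraticInvariant (I - ∑ n, a n • Elasticity.Z n) := by
    constructor
    · obtain ⟨B, hB⟩ := (Elasticity.exists_coeff_iff_exists_bilinForm I).1 hI.1
      refine (Elasticity.exists_coeff_iff_exists_bilinForm _).2
        ⟨B - ∑ n, a n • Elasticity.bilinZ n, fun C => ?_⟩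
      simp [hB, Elasticity.Z_eq_bilinZ, LinearMap.sum_apply]
    · intro O hO C
      simp [hI.2 O hO, fun n => (Elasticity.isQuadraticInvariant_Z n).2 O hO]
  have h := Elasticity.eq_zero_of_polarValues_eq_zero hJ
    (by rw [map_sub, map_sum, ← ha]; simp) C
  simpa [sub_eq_zero] using h
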